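/- **Setting.** A *pre-$\lambda$-graph* is a directed graph whose nodes are: application nodes $\mathtt{App}(n,m)$ with a left child $n$ and a right child $m$; abstraction nodes $\mathtt{Abs}(n)$ with one child, the body $n$; free variable nodes, without children, each carrying an atom that identifies it uniquely; and bound variable nodes $\mathtt{Var}(l)$, with a binding edge to an abstraction node $l$, the binder. *Paths* use only left, right and body edges (never binding edges); a *root* is a node that is the end of no non-empty path. A *$\lambda$-graph* is a pre-$\lambda$-graph that is finite, acyclic (no non-empty path from a node to itself), and dominated (every path from a root to a bound variable node $\mathtt{Var}(l)$ crosses $l$). Node $m$ is a *parent* of $n$ if there is a left, right or body edge from $m$ to $n$. Two nodes are *homogeneous* if both are applications, both abstractions, both free variables, or both bound variables; a relation on nodes is homogeneous if it relates only homogeneous nodes. A relation $R$ is *propagated* if $\mathtt{App}(n_1,n_2)\mathrel R\mathtt{App}(m_1,m_2)$ implies $n_1\mathrel R m_1$ and $n_2\mathrel R m_2$, and $\mathtt{Abs}(n)\mathrel R\mathtt{Abs}(m)$ implies $n\mathrel R m$. A *blind sharing equivalence* is a homogeneous, propagated equivalence relation. A *query* $Q$ is a binary relation on the roots; its *spreading*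 $Q^\#$ is the smallest propagated equivalence relation on the nodes that contains $Q$. **The blind check.** A non-failing program state consists of a multiset of undirected query edges (write $n\sim m$ if there is one between $n$ and $m$), partial functions $\mathtt{canonic}$, $\mathtt{building}$ and $\mathtt{queue}$ from the nodes to nodes, booleans and queues of nodes, and the execution stack. In an initial state for $Q$ the query edges are those of $Q$, the three partial functions are nowhere defined, and $\mathtt{BlindCheck}()$ is about to be called. The procedures are (loops iterate in any order): - $\mathtt{BlindCheck}()$: for every node $n$, if $\mathtt{canonic}(n)$ is undefined, call $\mathtt{BuildClass}(n)$. - $\mathtt{BuildClass}(c)$: set $\mathtt{canonic}(c):=c$, $\mathtt{building}(c):=\mathrm{true}$, $\mathtt{queue}(c):=\{c\}$. While $\mathtt{queue}(c)$ is non-empty, pop $n$ from it and do the following. First, for every parent $m$ of $n$: if $\mathtt{canonic}(m)$ is undefined, call $\mathtt{BuildClass}(m)$; otherwise, if $\mathtt{building}(\mathtt{canonic}(m))$ is true, fail. Then, for every $m$ with $n\sim m$: if $\mathtt{canonic}(m)$ is undefined, call $\mathtt{Enqueue}(m,c)$; otherwise, if $\mathtt{canonic}(m)\neq c$, fail. After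 the while loop, set $\mathtt{building}(c):=\mathrm{false}$. - $\mathtt{Enqueue}(m,c)$: if $m=\mathtt{Abs}(m')$ and $c=\mathtt{Abs}(c')$, create a query edge $m'\sim c'$; if $m=\mathtt{App}(m_1,m_2)$ and $c=\mathtt{App}(c_1,c_2)$, create query edges $m_1\sim c_1$ and $m_2\sim c_2$; if $m,c$ are both bound variables or both free variables, do nothing; in all other cases fail. Then set $\mathtt{canonic}(m):=c$ and push $m$ to $\mathtt{queue}(c)$. A state is *reachable* if it is the last state of a run that starts in an initial state for $Q$; a *final* state is a reachable non-fail state without further transitions. **Proposition (Correctness).** Let $Q$ be a query over a $\lambda$-graph $G$. In every final state $\mathcal S_f$ of the blind check on $Q$: 1. *Succinct representation:* for all nodes $n,m$: $\mathtt{canonic}(n)$ and $\mathtt{canonic}(m)$ are both defined and equal if and only if $n\mathrel{Q^\#}m$. 2. *Blind check:* $Q^\#$ is homogeneous, and therefore a blind sharing equivalence. -/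

import Mathlib

namespace LambdaSharing

/-! ### Lambda-graphs -/

/-- The label of a node together with its children; `bvar l` is a bound variable with binder `l`,
`fvar a` a free variable with identifier `a`. -/
inductive Label (V A : Type*)
  | app (left right : V)
  | abs (body : V)
  | fvar (ident : A)
  | bvar (binder : V)

/-- Both applications, both abstractions, both free variables, or both bound variables. -/
def Label.Homogeneous {V A : Type*} : Label V A → Label V A → Prop
  | .app _ _, .app _ _ => True
  | .abs _, .abs _ => True
  | .fvar _, .fvar _ => True
  | .bvar _, .bvar _ => True
  | _, _ => False

/-- Pre-lambda-graphs with nodes `V` and atoms `A`: identifiers determine free variable nodes, and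
binders are abstraction nodes. -/
structure PreLambdaGraph (V A : Type*) where
  label : V → Label V A
  ident_unique : ∀ n m a, label n = .fvar a → label m = .fvar a → n = m
  binder_abs : ∀ n l, label n = .bvar l → ∃ b, label l = .abs b

/-- Directions; binding edges are not directions. -/
inductive Dir
  | left
  | down
  | right

namespace PreLambdaGraph

variable {V A : Type*} (G : PreLambdaGraph V A)

/-- `G.Path τ n m`: there is a path of trace `τ` from `n` to `m`. The head of the list `τ` is the
last direction taken. -/
inductive Path : List Dir → V → V → Prop
  | nil (n : V) : Path [] n n
  | down {τ : List Dir} {n p m : V} :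
      Path τ n p → G.label p = .abs m → Path (Dir.down :: τ) n m
  | left {τ : List Dir} {n p m₁ m₂ : V} :
      Path τ n p → G.label p = .app m₁ m₂ → Path (Dir.left :: τ) n m₁
  | right {τ : List Dir} {n p m₁ m₂ : V} :
      Path τ n p → G.label p = .app m₁ m₂ → Path (Dir.right :: τ) n m₂

def IsRoot (r : V) : Prop := ∀ τ n, G.Path τ n r → τ = []

/-- `G.Crosses τ n m`: the path of trace `τ` starting at `n` crosses `m`. -/
inductive Crosses : List Dir → V → V → Prop
  | here {τ : List Dir} {n m : V} : G.Path τ n m → Crosses τ n m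
  | step {d : Dir} {τ : List Dir} {n m p : V} :
      Crosses τ n m → G.Path (d :: τ) n p → Crosses (d :: τ) n m

/-- `m` dominates `n`. -/
def Dominates (m n : V) : Prop := ∀ r τ, G.IsRoot r → G.Path τ r n → G.Crosses τ r m

def Acyclic : Prop := ∀ n τ, G.Path τ n n ↔ τ = []

def Dominated : Prop := ∀ n l, G.label n = .bvar l → G.Dominates l n

/-- `m` is a parent of `n`; binding edges do not count. -/
def IsParent (m n : V) : Prop := ∃ d, G.Path [d] m n

/-! ### Relations on nodes -/

def HomogeneousRel (R : V → V → Prop) : Prop :=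
  ∀ n m, R n m → (G.label n).Homogeneous (G.label m)

/-- Closure under the three downward propagation rules. -/
structure Propagated (R : V → V → Prop) : Prop where
  left : ∀ n m n₁ n₂ m₁ m₂, G.label n = .app n₁ n₂ → G.label m = .app m₁ m₂ → R n m → R n₁ m₁
  right : ∀ n m n₁ n₂ m₁ m₂, G.label n = .app n₁ n₂ → G.label m = .app m₁ m₂ → R n m → R n₂ m₂
  down : ∀ n m n' m', G.label n = .abs n' → G.label m = .abs m' → R n m → R n' m'

structure BlindBisimulation (R : V → V → Prop) : Prop where
  homogeneous : G.HomogeneousRel R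
  propagated : G.Propagated R

structure BlindSharingEquivalence (R : V → V → Prop) : Prop where
  equivalence : Equivalence R
  bisimulation : G.BlindBisimulation R

/-- A query relates root nodes only. -/
def IsQuery (Q : V → V → Prop) : Prop := ∀ n m, Q n m → G.IsRoot n ∧ G.IsRoot m

/-- The spreading of `R`. -/
inductive Spreading (R : V → V → Prop) : V → V → Prop
  | base {n m : V} : R n m → Spreading R n m
  | refl (n : V) : Spreading R n n
  | symm {n m : V} : Spreading R n m → Spreading R m n
  | trans {n m p : V} : Spreading R n m → Spreading R m p → Spreading R n p
  | left {n m n₁ n₂ m₁ m₂ : V} : G.label n = .app n₁ n₂ → G.label m = .app m₁ m₂ →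
      Spreading R n m → Spreading R n₁ m₁
  | right {n m n₁ n₂ m₁ m₂ : V} : G.label n = .app n₁ n₂ → G.label m = .app m₁ m₂ →
      Spreading R n m → Spreading R n₂ m₂
  | down {n m n' m' : V} : G.label n = .abs n' → G.label m = .abs m' →
      Spreading R n m → Spreading R n' m'

end PreLambdaGraph

/-- Lambda-graphs: finite, acyclic, dominated pre-lambda-graphs. -/
structure LambdaGraph (V A : Type*) extends PreLambdaGraph V A where
  finite : Finite V
  acyclic : toPreLambdaGraph.Acyclic
  dominated : toPreLambdaGraph.Dominated

/-! ### The blind check -/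

/-- Activation frames of the execution stack: each records the line to be executed next and the
values of the local variables. A loop keeps what it has still to iterate on (`rest`). -/
inductive Frame (V : Type*)
  /-- call of `BlindCheck()` -/
  | blindCheck
  /-- `for every node n` -/
  | nodeLoop (rest : Set V)
  /-- `if canonic(n) undefined then BuildClass(n)` -/
  | nodeBody (rest : Set V) (n : V)
  /-- `BuildClass(c)`: `canonic(c) := c` -/
  | buildCanonic (c : V)
  /-- `building(c) := true` -/
  | buildFlag (c : V)
  /-- `queue(c) := {c}` -/
  | buildQueue (c : V)
  /-- `while queue(c) is non-empty do n := queue(c).pop()` -/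
  | whileLoop (c : V)
  /-- `for every parent m of n` -/
  | parentLoop (c n : V) (rest : Set V)
  /-- `case canonic(m) of undefined => BuildClass(m) | c' => if building(c') then fail` -/
  | parentBody (c n : V) (rest : Set V) (m : V)
  /-- `for every neighbour m of n along a query edge` -/
  | siblingLoop (c n : V) (rest : Multiset (Sym2 V))
  /-- `case canonic(m) of undefined => Enqueue(m, c) | c' => if c' ≠ c then fail` -/
  | siblingBody (c n : V) (rest : Multiset (Sym2 V)) (m : V)
  /-- `building(c) := false`, then return -/
  | buildEnd (c : V)
  /-- `Enqueue(m, c)`: the case distinction on the labels of `m` and `c` -/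
  | enqueueCase (m c : V)
  /-- `canonic(m) := c` -/
  | enqueueCanonic (m c : V)
  /-- `queue(c).push(m)`, then return -/
  | enqueuePush (m c : V)

/-- The data of a non-failing program state over a graph with nodes `V`; `none` is `undefined`.
The head of `stack` is the innermost active call. -/
structure State (V : Type*) where
  edges : Multiset (Sym2 V)
  canonic : V → Option V
  building : V → Option Bool
  queue : V → Option (List V)
  stack : List (Frame V)

namespace State

variable {V : Type*} (S : State V)

def goto (σ : List (Frame V)) : State V := { S with stack := σ }

def addEdge (n m : V) : State V := { S with edges := s(n, m) ::ₘ S.edges }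

open Classical in
noncomputable def setCanonic (n c : V) : State V :=
  { S with canonic := Function.update S.canonic n (some c) }

open Classical in
noncomputable def setBuilding (c : V) (b : Bool) : State V :=
  { S with building := Function.update S.building c (some b) }

open Classical in
noncomputable def setQueue (c : V) (q : List V) : State V :=
  { S with queue := Function.update S.queue c (some q) }

/-- The contents of the queue of `c`. -/
def queueOf (c : V) : List V := (S.queue c).getD []

open Classical in
/-- The query edges with endnode `n`, with multiplicity. -/
noncomputable def edgesAt (n : V) : Multiset (Sym2 V) := S.edges.filter (fun e => n ∈ e)

/-- The canonic representatives of `n` and `m` are both defined and coincide. -/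
def SameCanonic (n m : V) : Prop := ∃ c, S.canonic n = some c ∧ S.canonic m = some c

end State

/-- Program states: the fail state, or a proper state. -/
inductive Config (V : Type*)
  | fail
  | run (S : State V)

namespace PreLambdaGraph

variable {V A : Type*} (G : PreLambdaGraph V A)

/-- Program transitions. Loops iterate in an arbitrary order. In every rule `σ` is the part of the
execution stack below the frame that is being executed. -/
inductive Step : Config V → Config V → Prop
  | callBlindCheck {S : State V} {σ : List (Frame V)} :
      S.stack = .blindCheck :: σ →
      Step (.run S) (.run (S.goto (.nodeLoop Set.univ :: σ)))
  | nodeNext {S : State V} {σ : List (Frame V)} {rest : Set V} {n : V} :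
      S.stack = .nodeLoop rest :: σ → n ∈ rest →
      Step (.run S) (.run (S.goto (.nodeBody (rest \ {n}) n :: σ)))
  | nodeExit {S : State V} {σ : List (Frame V)} {rest : Set V} :
      S.stack = .nodeLoop rest :: σ → rest = ∅ →
      Step (.run S) (.run (S.goto σ))
  | nodeBuild {S : State V} {σ : List (Frame V)} {rest : Set V} {n : V} :
      S.stack = .nodeBody rest n :: σ → S.canonic n = none →
      Step (.run S) (.run (S.goto (.buildCanonic n :: .nodeLoop rest :: σ)))
  | nodeSkip {S : State V} {σ : List (Frame V)} {rest : Set V} {n c' : V} :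
      S.stack = .nodeBody rest n :: σ → S.canonic n = some c' →
      Step (.run S) (.run (S.goto (.nodeLoop rest :: σ)))
  | buildCanonic {S : State V} {σ : List (Frame V)} {c : V} :
      S.stack = .buildCanonic c :: σ →
      Step (.run S) (.run ((S.setCanonic c c).goto (.buildFlag c :: σ)))
  | buildFlag {S : State V} {σ : List (Frame V)} {c : V} :
      S.stack = .buildFlag c :: σ →
      Step (.run S) (.run ((S.setBuilding c true).goto (.buildQueue c :: σ)))
  | buildQueue {S : State V} {σ : List (Frame V)} {c : V} :
      S.stack = .buildQueue c :: σ →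
      Step (.run S) (.run ((S.setQueue c [c]).goto (.whileLoop c :: σ)))
  | whilePop {S : State V} {σ : List (Frame V)} {c n : V} {q : List V} :
      S.stack = .whileLoop c :: σ → S.queueOf c = n :: q →
      Step (.run S) (.run ((S.setQueue c q).goto (.parentLoop c n {m | G.IsParent m n} :: σ)))
  | whileExit {S : State V} {σ : List (Frame V)} {c : V} :
      S.stack = .whileLoop c :: σ → S.queueOf c = [] →
      Step (.run S) (.run (S.goto (.buildEnd c :: σ)))
  | parentNext {S : State V} {σ : List (Frame V)} {c n m : V} {rest : Set V} :
      S.stack = .parentLoop c n rest :: σ → m ∈ rest →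
      Step (.run S) (.run (S.goto (.parentBody c n (rest \ {m}) m :: σ)))
  | parentExit {S : State V} {σ : List (Frame V)} {c n : V} {rest : Set V} :
      S.stack = .parentLoop c n rest :: σ → rest = ∅ →
      Step (.run S) (.run (S.goto (.siblingLoop c n (S.edgesAt n) :: σ)))
  | parentBuild {S : State V} {σ : List (Frame V)} {c n m : V} {rest : Set V} :
      S.stack = .parentBody c n rest m :: σ → S.canonic m = none →
      Step (.run S) (.run (S.goto (.buildCanonic m :: .parentLoop c n rest :: σ)))
  | parentFail {S : State V} {σ : List (Frame V)} {c n m c' : V} {rest : Set V} :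
      S.stack = .parentBody c n rest m :: σ → S.canonic m = some c' →
      S.building c' = some true →
      Step (.run S) .fail
  | parentSkip {S : State V} {σ : List (Frame V)} {c n m c' : V} {rest : Set V} :
      S.stack = .parentBody c n rest m :: σ → S.canonic m = some c' →
      S.building c' ≠ some true →
      Step (.run S) (.run (S.goto (.parentLoop c n rest :: σ)))
  | siblingNext {S : State V} {σ : List (Frame V)} {c n m : V} {rest : Multiset (Sym2 V)} :
      S.stack = .siblingLoop c n (s(n, m) ::ₘ rest) :: σ →
      Step (.run S) (.run (S.goto (.siblingBody c n rest m :: σ)))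
  | siblingExit {S : State V} {σ : List (Frame V)} {c n : V} :
      S.stack = .siblingLoop c n 0 :: σ →
      Step (.run S) (.run (S.goto (.whileLoop c :: σ)))
  | siblingEnqueue {S : State V} {σ : List (Frame V)} {c n m : V} {rest : Multiset (Sym2 V)} :
      S.stack = .siblingBody c n rest m :: σ → S.canonic m = none →
      Step (.run S) (.run (S.goto (.enqueueCase m c :: .siblingLoop c n rest :: σ)))
  | siblingFail {S : State V} {σ : List (Frame V)} {c n m c' : V} {rest : Multiset (Sym2 V)} :
      S.stack = .siblingBody c n rest m :: σ → S.canonic m = some c' → c' ≠ c →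
      Step (.run S) .fail
  | siblingSkip {S : State V} {σ : List (Frame V)} {c n m c' : V} {rest : Multiset (Sym2 V)} :
      S.stack = .siblingBody c n rest m :: σ → S.canonic m = some c' → c' = c →
      Step (.run S) (.run (S.goto (.siblingLoop c n rest :: σ)))
  | buildEnd {S : State V} {σ : List (Frame V)} {c : V} :
      S.stack = .buildEnd c :: σ →
      Step (.run S) (.run ((S.setBuilding c false).goto σ))
  | enqueueAbs {S : State V} {σ : List (Frame V)} {m c m' c' : V} :
      S.stack = .enqueueCase m c :: σ → G.label m = .abs m' → G.label c = .abs c' →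
      Step (.run S) (.run ((S.addEdge m' c').goto (.enqueueCanonic m c :: σ)))
  | enqueueApp {S : State V} {σ : List (Frame V)} {m c m₁ m₂ c₁ c₂ : V} :
      S.stack = .enqueueCase m c :: σ → G.label m = .app m₁ m₂ → G.label c = .app c₁ c₂ →
      Step (.run S)
        (.run (((S.addEdge m₁ c₁).addEdge m₂ c₂).goto (.enqueueCanonic m c :: σ)))
  | enqueueBVar {S : State V} {σ : List (Frame V)} {m c l l' : V} :
      S.stack = .enqueueCase m c :: σ → G.label m = .bvar l → G.label c = .bvar l' →
      Step (.run S) (.run (S.goto (.enqueueCanonic m c :: σ)))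
  | enqueueFVar {S : State V} {σ : List (Frame V)} {m c : V} {a a' : A} :
      S.stack = .enqueueCase m c :: σ → G.label m = .fvar a → G.label c = .fvar a' →
      Step (.run S) (.run (S.goto (.enqueueCanonic m c :: σ)))
  | enqueueFail {S : State V} {σ : List (Frame V)} {m c : V} :
      S.stack = .enqueueCase m c :: σ → ¬ (G.label m).Homogeneous (G.label c) →
      Step (.run S) .fail
  | enqueueCanonic {S : State V} {σ : List (Frame V)} {m c : V} :
      S.stack = .enqueueCanonic m c :: σ →
      Step (.run S) (.run ((S.setCanonic m c).goto (.enqueuePush m c :: σ)))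
  | enqueuePush {S : State V} {σ : List (Frame V)} {m c : V} :
      S.stack = .enqueuePush m c :: σ →
      Step (.run S) (.run ((S.setQueue c (S.queueOf c ++ [m])).goto σ))

end PreLambdaGraph

/-- Initial states for the query `Q`: the undirected query edges are those of `Q` (with arbitrary
positive multiplicities), nothing else is defined, and `BlindCheck()` is about to be called. -/
structure State.IsInitial {V : Type*} (Q : V → V → Prop) (S : State V) : Prop where
  edges : ∀ n m, s(n, m) ∈ S.edges ↔ Q n m ∨ Q m n
  canonic : ∀ n, S.canonic n = none
  building : ∀ n, S.building n = none
  queue : ∀ n, S.queue n = none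
  stack : S.stack = [Frame.blindCheck]

namespace LambdaGraph

variable {V A : Type*} (G : LambdaGraph V A)

/-- `C` is the last state of a program run on the query `Q`. -/
def Reachable (Q : V → V → Prop) (C : Config V) : Prop :=
  ∃ S₀ : State V, S₀.IsInitial Q ∧
    Relation.ReflTransGen G.toPreLambdaGraph.Step (.run S₀) C

/-- `S` is a final state for the query `Q`: a reachable state, not the fail state, that has no
further transitions. -/
def IsFinal (Q : V → V → Prop) (S : State V) : Prop :=
  G.Reachable Q (.run S) ∧ ∀ C, ¬ G.toPreLambdaGraph.Step (.run S) C

end LambdaGraph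

end LambdaSharing

namespace LambdaSharing

/-! ### Labels -/

/-! Soundness is immediate: by propagation, all query edges stay inside the spreading, and so each
node is related by it to its representative. `Enqueue` also compares labels, so representatives are
homogeneous to their nodes. The converse needs having the same representative to be a propagated
equivalence that contains `Q`; as the spreading is the least such relation, the two then coincide.

Two facts give this. A node and its representative are equal, or query edges connect their
corresponding children (`linked`). And every query edge ends up inside one class: each assigned node
is in a queue, or is being visited, or is `Done`, meaning that its parents lie in complete classes
and its neighbours have its own representative (`progress`).

The crux is that `Done` is never undone, although query edges are added during the run. `Enqueue` on
`m` and `c` adds edges between children of `m` and of `c` only. At that moment `m` has no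
representative and the class of `c` is under construction, so no child of either has all its parents
in complete classes. New edges thus avoid `Done` nodes, and also nodes whose query edges are being
iterated on (`Good.enqueue`).

`Good` is the invariant, `RunInv.step` its preservation. A state without transitions has an empty
stack (`stack_eq_nil_of_final`); then no class is under construction, all queues are empty, and
every node is `Done` (`Good.done_of_nil`). `Good.sameCanonic_iff` concludes, and homogeneity follows
by comparing two related nodes with their common representative. -/

lemma Label.Homogeneous.refl {V A : Type*} (l : Label V A) : l.Homogeneous l := by
  cases l <;> trivial

lemma Label.Homogeneous.symm {V A : Type*} {l l' : Label V A} (h : l.Homogeneous l') :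
    l'.Homogeneous l := by
  cases l <;> cases l' <;> trivial

lemma Label.Homogeneous.trans {V A : Type*} {l l' l'' : Label V A} (h : l.Homogeneous l')
    (h' : l'.Homogeneous l'') : l.Homogeneous l'' := by
  cases l <;> cases l' <;> cases l'' <;> trivial

/-! ### Frames -/

/-- The class that is under construction in a frame. -/
def Frame.owner {V : Type*} : Frame V → Option V
  | .whileLoop c => some c
  | .parentLoop c _ _ => some c
  | .parentBody c _ _ _ => some c
  | .siblingLoop c _ _ => some c
  | .siblingBody c _ _ _ => some c
  | .buildEnd c => some c
  | _ => none

/-- The node whose parents or neighbours are being visited in a frame. -/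
def Frame.visited {V : Type*} : Frame V → Option V
  | .parentLoop _ n _ => some n
  | .parentBody _ n _ _ => some n
  | .siblingLoop _ n _ => some n
  | .siblingBody _ n _ _ => some n
  | _ => none

/-- The initializing frames of `BuildClass` contribute nothing, since the invariant is evaluated
only after they are flushed; an `Enqueue` frame lies above a loop frame that already names its
class. -/
def owners {V : Type*} (σ : List (Frame V)) : Set V := {c | ∃ f ∈ σ, f.owner = some c}

def visiteds {V : Type*} (σ : List (Frame V)) : Set V := {n | ∃ f ∈ σ, f.visited = some n}

@[simp] lemma mem_owners_nil {V : Type*} (c : V) : c ∈ owners ([] : List (Frame V)) ↔ False := by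
  simp [owners]

@[simp] lemma mem_owners_cons {V : Type*} (f : Frame V) (σ : List (Frame V)) (c : V) :
    c ∈ owners (f :: σ) ↔ f.owner = some c ∨ c ∈ owners σ := by
  simp [owners]

@[simp] lemma mem_visiteds_nil {V : Type*} (n : V) :
    n ∈ visiteds ([] : List (Frame V)) ↔ False := by
  simp [visiteds]

@[simp] lemma mem_visiteds_cons {V : Type*} (f : Frame V) (σ : List (Frame V)) (n : V) :
    n ∈ visiteds (f :: σ) ↔ f.visited = some n ∨ n ∈ visiteds σ := by
  simp [visiteds]

namespace State

variable {V : Type*}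

/-- The state reached once the straight-line code on top of the stack has been executed: the
initializations of `BuildClass`, or the end of `Enqueue`. -/
noncomputable def flush (S : State V) : State V :=
  match S.stack with
  | .buildCanonic c :: σ =>
      (((S.setCanonic c c).setBuilding c true).setQueue c [c]).goto (.whileLoop c :: σ)
  | .buildFlag c :: σ => ((S.setBuilding c true).setQueue c [c]).goto (.whileLoop c :: σ)
  | .buildQueue c :: σ => (S.setQueue c [c]).goto (.whileLoop c :: σ)
  | .enqueueCanonic m c :: σ =>
      ((S.setCanonic m c).setQueue c (S.queueOf c ++ [m])).goto σ
  | .enqueuePush m c :: σ => (S.setQueue c (S.queueOf c ++ [m])).goto σ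
  | _ => S

/-- The class of `m` is complete. -/
def SettledNode (S : State V) (m : V) : Prop :=
  ∃ c, S.canonic m = some c ∧ S.building c = some false

end State

namespace PreLambdaGraph

variable {V A : Type*} (G : PreLambdaGraph V A)

lemma isParent_abs {n m : V} (h : G.label n = .abs m) : G.IsParent n m :=
  ⟨.down, .down (.nil n) h⟩

lemma isParent_left {n m₁ m₂ : V} (h : G.label n = .app m₁ m₂) : G.IsParent n m₁ :=
  ⟨.left, .left (.nil n) h⟩

lemma isParent_right {n m₁ m₂ : V} (h : G.label n = .app m₁ m₂) : G.IsParent n m₂ :=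
  ⟨.right, .right (.nil n) h⟩

/-! ### The invariant -/

/-- The classes of all parents of `n` are complete. -/
def Settled (S : State V) (n : V) : Prop := ∀ m, G.IsParent m n → S.SettledNode m

/-- The node `n` of the class `c` needs no more work. -/
def Done (S : State V) (c n : V) : Prop :=
  G.Settled S n ∧ ∀ m, s(n, m) ∈ S.edges → S.canonic m = some c

/-- Corresponding children of `n` and `c` are connected by query edges. -/
structure Linked (E : Multiset (Sym2 V)) (n c : V) : Prop where
  app : ∀ n₁ n₂ c₁ c₂, G.label n = .app n₁ n₂ → G.label c = .app c₁ c₂ →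
    s(n₁, c₁) ∈ E ∧ s(n₂, c₂) ∈ E
  abs : ∀ n' c', G.label n = .abs n' → G.label c = .abs c' → s(n', c') ∈ E

/-- The part of the invariant about the data of the state. `O` is the set of the classes under
construction, `T` the set of the nodes that are being visited. -/
structure DataInv (Q : V → V → Prop) (S : State V) (O T : Set V) : Prop where
  sound : ∀ n m, s(n, m) ∈ S.edges → G.Spreading Q n m
  query : ∀ n m, Q n m → s(n, m) ∈ S.edges
  spreading : ∀ n c, S.canonic n = some c → G.Spreading Q n c
  homogeneous : ∀ n c, S.canonic n = some c → (G.label n).Homogeneous (G.label c)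
  -- A representative needs no edges to itself, hence the first alternative.
  linked : ∀ n c, S.canonic n = some c → n = c ∨ G.Linked S.edges n c
  building_ne : ∀ n c, S.canonic n = some c → S.building c ≠ none
  canonic_self : ∀ c, S.building c ≠ none → S.canonic c = some c
  owner : ∀ c, S.building c = some true → c ∈ O
  canonic_of_queue : ∀ n c, n ∈ S.queueOf c → S.canonic n = some c
  building_of_queue : ∀ n c, n ∈ S.queueOf c → S.building c = some true
  progress : ∀ n c, S.canonic n = some c → n ∈ S.queueOf c ∨ n ∈ T ∨ G.Done S c n

/-- The stack consists of loops that wait for the completion of the class of `h`, if any. -/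
def Waiting (S : State V) : Option V → List (Frame V) → Prop
  | h, [.nodeLoop rest] => ∀ n, n ∈ rest ∨ (∃ c, S.canonic n = some c) ∨ h = some n
  | h, .parentLoop c n rest :: σ =>
      S.canonic n = some c ∧ (∀ m, G.IsParent m n → m ∈ rest ∨ S.SettledNode m ∨ h = some m) ∧
        S.building c = some true ∧ c ∉ owners σ ∧ Waiting S (some c) σ
  | _, _ => False

/-- The class `c` is under construction above the stack `σ`. -/
def Active (S : State V) (c : V) (σ : List (Frame V)) : Prop :=
  S.building c = some true ∧ c ∉ owners σ ∧ G.Waiting S (some c) σ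

/-- The loop over the query edges of `n` has still to treat `rest` and the neighbour `h`, if
any. -/
structure SiblingInv (S : State V) (h : Option V) (c n : V) (rest : Multiset (Sym2 V))
    (σ : List (Frame V)) : Prop where
  active : G.Active S c σ
  canonic : S.canonic n = some c
  settled : G.Settled S n
  treated : ∀ m, s(n, m) ∈ S.edges → s(n, m) ∈ rest ∨ S.canonic m = some c ∨ h = some m
  mem_of_rest : ∀ e ∈ rest, n ∈ e
  edge_of_rest : ∀ e ∈ rest, e ∈ S.edges

/-- The part of the invariant about the execution stack. -/
def Control (S : State V) : List (Frame V) → Prop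
  | [] => ∀ n, ∃ c, S.canonic n = some c
  | .blindCheck :: σ => σ = []
  | .nodeBody rest n :: σ => σ = [] ∧ G.Waiting S (some n) [.nodeLoop rest]
  | .nodeLoop rest :: σ => G.Waiting S none (.nodeLoop rest :: σ)
  | .parentLoop c n rest :: σ => G.Waiting S none (.parentLoop c n rest :: σ)
  | .parentBody c n rest m :: σ => G.Waiting S (some m) (.parentLoop c n rest :: σ)
  | .whileLoop c :: σ => G.Active S c σ
  | .buildEnd c :: σ => G.Active S c σ ∧ S.queueOf c = []
  | .siblingLoop c n rest :: σ => G.SiblingInv S none c n rest σ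
  | .siblingBody c n rest m :: σ => G.SiblingInv S (some m) c n rest σ ∧ s(n, m) ∈ S.edges
  | .enqueueCase m c :: σ => S.canonic m = none ∧ ∃ n rest σ', σ = .siblingLoop c n rest :: σ' ∧
      G.SiblingInv S (some m) c n rest σ' ∧ s(n, m) ∈ S.edges
  | _ => False

/-- The stack is a separate argument: no condition reads `S.stack`, so the data can be kept fixed
while frames are exchanged. -/
structure Good (Q : V → V → Prop) (S : State V) (σ : List (Frame V)) : Prop where
  data : G.DataInv Q S (owners σ) (visiteds σ)
  control : G.Control S σ

variable {G} {Q : V → V → Prop} {S S' : State V}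

/-! ### Monotonicity -/

/-- `S'` extends `S` as far as assigned representatives and complete classes are concerned. -/
structure Extends (S S' : State V) : Prop where
  canonic : ∀ n c, S.canonic n = some c → S'.canonic n = some c
  building : ∀ c, S.building c = some false → S'.building c = some false

lemma Extends.settledNode (h : Extends S S') {m : V} (hm : S.SettledNode m) :
    S'.SettledNode m := by
  obtain ⟨c, h₁, h₂⟩ := hm
  exact ⟨c, h.canonic _ _ h₁, h.building _ h₂⟩

lemma Extends.settled (h : Extends S S') {n : V} (hn : G.Settled S n) : G.Settled S' n :=
  fun m hm => h.settledNode (hn m hm)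

/-- New edges are harmless if they avoid nodes whose parents are all settled, so `hE` may assume
`G.Settled S n`. -/
lemma Extends.done (h : Extends S S') {c n : V} (hn : G.Done S c n)
    (hE : ∀ m, G.Settled S n → s(n, m) ∈ S'.edges → s(n, m) ∈ S.edges) : G.Done S' c n :=
  ⟨h.settled hn.1, fun m hm => h.canonic _ _ (hn.2 m (hE m hn.1 hm))⟩

/-- The awaited node `h` acts as a hole in the topmost loop: it may stay awaited or become settled.
Deeper holes are the classes named by the frames above them and do not change. -/
lemma Extends.waiting (hS : Extends S S') {h h' : Option V} {σ : List (Frame V)}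
    (hσ : G.Waiting S h σ)
    (hh : ∀ x, h = some x → h' = some x ∨ S'.SettledNode x)
    (hO : ∀ c ∈ owners σ, S.building c = some true → S'.building c = some true) :
    G.Waiting S' h' σ := by
  induction σ generalizing h h' with
  | nil => simp [Waiting] at hσ
  | cons f σ ih =>
    cases f with
    | nodeLoop rest =>
      cases σ with
      | nil =>
        simp only [Waiting] at hσ ⊢
        intro n
        rcases hσ n with h₁ | ⟨c, h₁⟩ | h₁
        · exact .inl h₁
        · exact .inr (.inl ⟨c, hS.canonic _ _ h₁⟩)
        · rcases hh n h₁ with h₂ | ⟨c, h₂, -⟩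
          · exact .inr (.inr h₂)
          · exact .inr (.inl ⟨c, h₂⟩)
      | cons _ _ => simp [Waiting] at hσ
    | parentLoop c n rest =>
      simp only [Waiting] at hσ ⊢
      obtain ⟨h₁, h₂, h₃, h₄, h₅⟩ := hσ
      refine ⟨hS.canonic _ _ h₁, fun m hm => ?_, hO c (by simp [Frame.owner]) h₃, h₄,
        ih h₅ (fun x hx => .inl hx) fun c hc => hO c (by simp [hc])⟩
      rcases h₂ m hm with h | h | h
      · exact .inl h
      · exact .inr (.inl (hS.settledNode h))
      · exact (hh m h).elim (fun h => .inr (.inr h)) fun h => .inr (.inl h)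
    | _ => simp [Waiting] at hσ

lemma Waiting.building {h : Option V} {σ : List (Frame V)} (hσ : G.Waiting S h σ) {c : V}
    (hc : c ∈ owners σ) : S.building c = some true := by
  induction σ generalizing h with
  | nil => simp at hc
  | cons f σ ih =>
    cases f with
    | nodeLoop rest =>
      cases σ with
      | nil => simp [Frame.owner] at hc
      | cons _ _ => simp [Waiting] at hσ
    | parentLoop c' n rest =>
      simp only [Waiting] at hσ
      obtain ⟨h₁, h₂, h₃, h₄, h₅⟩ := hσ
      simp only [mem_owners_cons, Frame.owner, Option.some.injEq] at hc
      rcases hc with rfl | hc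
      · exact h₃
      · exact ih h₅ hc
    | _ => simp [Waiting] at hσ

lemma Waiting.control {σ : List (Frame V)} (hσ : G.Waiting S none σ) : G.Control S σ := by
  cases σ with
  | nil => simp [Waiting] at hσ
  | cons f σ => cases f <;> first | exact hσ | simp [Waiting] at hσ

/-- `Control` is `False` on every frame that `flush` would execute. -/
lemma Control.flush {σ : List (Frame V)} (hσ : G.Control S σ) (S' : State V) :
    (S'.goto σ).flush = S'.goto σ := by
  cases σ with
  | nil => rfl
  | cons f σ => cases f <;> first | rfl | exact hσ.elim

/-- A node may leave the set of visited nodes only once it is `Done`, which moves it to the last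
alternative of `progress`. -/
lemma DataInv.mono {O O' T T' : Set V} (h : G.DataInv Q S O T)
    (hO : ∀ c ∈ O, c ∈ O')
    (hT : ∀ n ∈ T, n ∈ T' ∨ ∃ c, S.canonic n = some c ∧ G.Done S c n) :
    G.DataInv Q S O' T' where
  __ := h
  owner c hc := hO c (h.owner c hc)
  progress n c hn := by
    rcases h.progress n c hn with h₁ | h₁ | h₁
    · exact .inl h₁
    · rcases hT n h₁ with h₂ | ⟨c', h₂, h₃⟩
      · exact .inr (.inl h₂)
      · obtain rfl : c = c' := by simpa [hn] using h₂
        exact .inr (.inr h₃)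
    · exact .inr (.inr h₁)

lemma DataInv.building_none {O T : Set V} (h : G.DataInv Q S O T) {c : V}
    (hc : S.canonic c = none) : S.building c = none := by
  by_contra hb
  simp [h.canonic_self c hb] at hc

/-! ### Preservation -/

lemma Good.build {c : V} {σ : List (Frame V)} {T : Set V}
    (hd : G.DataInv Q S (owners σ) T) (hT : ∀ n ∈ T, n ∈ visiteds σ)
    (hc : S.canonic c = none) (hw : G.Waiting S (some c) σ) :
    G.Good Q (((S.setCanonic c c).setBuilding c true).setQueue c [c]) (.whileLoop c :: σ) := by
  classical
  have hb := hd.building_none hc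
  have hcan : ∀ n, n ≠ c → (((S.setCanonic c c).setBuilding c true).setQueue c [c]).canonic n
      = S.canonic n := fun n h => by
    simp [State.setCanonic, State.setBuilding, State.setQueue, h]
  have hbu : ∀ c', c' ≠ c → (((S.setCanonic c c).setBuilding c true).setQueue c [c]).building c'
      = S.building c' := fun c' h => by
    simp [State.setCanonic, State.setBuilding, State.setQueue, h]
  have hbc : (((S.setCanonic c c).setBuilding c true).setQueue c [c]).building c
      = some true := by
    simp [State.setCanonic, State.setBuilding, State.setQueue]
  have hq : ∀ c', c' ≠ c → (((S.setCanonic c c).setBuilding c true).setQueue c [c]).queueOf c'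
      = S.queueOf c' := fun c' h => by
    simp [State.setCanonic, State.setBuilding, State.setQueue, State.queueOf, h]
  have hqc : (((S.setCanonic c c).setBuilding c true).setQueue c [c]).queueOf c = [c] := by
    simp [State.setQueue, State.queueOf]
  have hcc : (((S.setCanonic c c).setBuilding c true).setQueue c [c]).canonic c = some c := by
    simp [State.setCanonic, State.setBuilding, State.setQueue]
  have hE : (((S.setCanonic c c).setBuilding c true).setQueue c [c]).edges = S.edges := rfl
  -- From here on the new state is known only through the equations above.
  generalize ((S.setCanonic c c).setBuilding c true).setQueue c [c] = S' at *
  have hext : Extends S S' := by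
    refine ⟨fun n c' hn => ?_, fun c' hc' => ?_⟩
    · rwa [hcan n (by rintro rfl; simp [hc] at hn)]
    · rwa [hbu c' (by rintro rfl; simp [hb] at hc')]
  -- Classes owned by waiting frames have the flag `true`, whereas the flag of `c` is still
  -- undefined.
  have hO : c ∉ owners σ := fun h => by simpa [hb] using hw.building h
  have hne : ∀ n c', n ≠ c → S.canonic n = some c' → c' ≠ c := by
    rintro n c' - hn rfl
    exact hd.building_ne n c' hn hb
  refine ⟨⟨?_, ?_, ?_, ?_, ?_, ?_, ?_, ?_, ?_, ?_, ?_⟩, hbc, hO, ?_⟩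
  · rw [hE]; exact hd.sound
  · rw [hE]; exact hd.query
  · intro n c' hn
    by_cases h : n = c
    · subst h
      obtain rfl : n = c' := by simpa [hcc] using hn
      exact .refl n
    · exact hd.spreading n c' (hcan n h ▸ hn)
  · intro n c' hn
    by_cases h : n = c
    · subst h
      obtain rfl : n = c' := by simpa [hcc] using hn
      exact .refl _
    · exact hd.homogeneous n c' (hcan n h ▸ hn)
  · intro n c' hn
    by_cases h : n = c
    · subst h
      exact .inl (by simpa [hcc] using hn)
    · rw [hE]; exact hd.linked n c' (hcan n h ▸ hn)
  · intro n c' hn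
    by_cases h : c' = c
    · subst h; simp [hbc]
    · rw [hbu _ h]
      refine hd.building_ne n c' ?_
      rwa [← hcan n]
      rintro rfl
      exact h (by simpa [hcc] using hn.symm)
  · intro c' hb'
    by_cases h : c' = c
    · subst h; exact hcc
    · rw [hcan _ h]; exact hd.canonic_self c' (hbu c' h ▸ hb')
  · intro c' hb'
    by_cases h : c' = c
    · subst h; simp [Frame.owner]
    · simp [hd.owner c' (hbu c' h ▸ hb')]
  · intro n c' hn
    by_cases h : c' = c
    · subst h
      obtain rfl : n = c' := by simpa [hqc] using hn
      exact hcc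
    · exact hext.canonic _ _ (hd.canonic_of_queue n c' (hq c' h ▸ hn))
  · intro n c' hn
    by_cases h : c' = c
    · subst h; exact hbc
    · rw [hbu _ h]; exact hd.building_of_queue n c' (hq c' h ▸ hn)
  · intro n c' hn
    by_cases h : n = c
    · subst h
      obtain rfl : n = c' := by simpa [hcc] using hn
      simp [hqc]
    · have hn' := hcan n h ▸ hn
      rcases hd.progress n c' hn' with h₁ | h₁ | h₁
      · rw [hq _ (hne n c' h hn')]; exact .inl h₁
      · simp [hT n h₁]
      · exact .inr (.inr (hext.done h₁ fun m _ hm => hE ▸ hm))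
  · refine hext.waiting hw (fun x hx => .inl hx) fun c' hc' hb' => ?_
    rwa [hbu c' (by rintro rfl; exact hO hc')]

/-- The edge multiset `E` abstracts from the shape of the labels, so that one argument serves all
successful cases of `Enqueue`. By `hnew`, an added edge is justified by propagation from `m` and
`c`, and its endpoints are children of these; as `E` is symmetric in its endpoints, a condition on
`x` alone suffices. -/
lemma Good.enqueue {c n m : V} {rest : Multiset (Sym2 V)} {σ : List (Frame V)}
    {E : Multiset (Sym2 V)}
    (hd : G.DataInv Q S (owners (.siblingLoop c n rest :: σ))
      (visiteds (.siblingLoop c n rest :: σ)))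
    (hs : G.SiblingInv S (some m) c n rest σ) (hm : S.canonic m = none)
    (hnm : s(n, m) ∈ S.edges) (hsub : ∀ e ∈ S.edges, e ∈ E)
    (hnew : ∀ x y, s(x, y) ∈ E → s(x, y) ∈ S.edges ∨
      (G.Spreading Q m c → G.Spreading Q x y) ∧ (G.IsParent m x ∨ G.IsParent c x))
    (hhom : (G.label m).Homogeneous (G.label c)) (hlink : G.Linked E m c) :
    G.Good Q ((({ S with edges := E } : State V).setCanonic m c).setQueue c
      (S.queueOf c ++ [m])) (.siblingLoop c n rest :: σ) := by
  classical
  have hspr : G.Spreading Q m c :=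
    .trans (.symm (hd.sound _ _ hnm)) (hd.spreading _ _ hs.canonic)
  have hcan : ∀ x, x ≠ m → ((({ S with edges := E } : State V).setCanonic m c).setQueue c
      (S.queueOf c ++ [m])).canonic x = S.canonic x := fun x h => by
    simp [State.setCanonic, State.setQueue, h]
  have hbu : ((({ S with edges := E } : State V).setCanonic m c).setQueue c
      (S.queueOf c ++ [m])).building = S.building := rfl
  have hq : ∀ c', c' ≠ c → ((({ S with edges := E } : State V).setCanonic m c).setQueue c
      (S.queueOf c ++ [m])).queueOf c' = S.queueOf c' := fun c' h => by
    simp [State.setCanonic, State.setQueue, State.queueOf, h]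
  have hqc : ((({ S with edges := E } : State V).setCanonic m c).setQueue c
      (S.queueOf c ++ [m])).queueOf c = S.queueOf c ++ [m] := by
    simp [State.setQueue, State.queueOf]
  have hcc : ((({ S with edges := E } : State V).setCanonic m c).setQueue c
      (S.queueOf c ++ [m])).canonic m = some c := by
    simp [State.setCanonic, State.setQueue]
  have hE : ((({ S with edges := E } : State V).setCanonic m c).setQueue c
      (S.queueOf c ++ [m])).edges = E := rfl
  generalize (({ S with edges := E } : State V).setCanonic m c).setQueue c
      (S.queueOf c ++ [m]) = S' at *
  have hext : Extends S S' := by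
    refine ⟨fun x c' hx => ?_, fun c' hc' => by rwa [hbu]⟩
    rwa [hcan x (by rintro rfl; simp [hm] at hx)]
  have hbc := hs.active.1
  -- A settled node has no parent without representative, such as `m`, and none in a class under
  -- construction, such as `c`.
  have hunsettled : ∀ x, G.Settled S x → ¬ (G.IsParent m x ∨ G.IsParent c x) := by
    rintro x hx (h | h)
    · obtain ⟨d, h₁, -⟩ := hx m h
      simp [hm] at h₁
    · obtain ⟨d, h₁, h₂⟩ := hx c h
      obtain rfl : c = d := by simpa [hd.canonic_self c (by simp [hbc])] using h₁
      simp [hbc] at h₂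
  have hold : ∀ x y, G.Settled S x → s(x, y) ∈ E → s(x, y) ∈ S.edges := fun x y hx hxy =>
    (hnew x y hxy).resolve_right fun h => hunsettled x hx h.2
  have hqueue : ∀ x c', x ∈ S.queueOf c' → x ∈ S'.queueOf c' := by
    intro x c' hx
    by_cases h : c' = c
    · subst h; simp [hqc, hx]
    · rwa [hq _ h]
  refine ⟨⟨?_, ?_, ?_, ?_, ?_, ?_, ?_, ?_, ?_, ?_, ?_⟩, ⟨?_, ?_, ?_⟩, ?_, ?_, ?_, ?_, ?_⟩
  · intro x y hxy
    rcases hnew x y (hE ▸ hxy) with h | h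
    · exact hd.sound x y h
    · exact h.1 hspr
  · intro x y hxy
    rw [hE]
    exact hsub _ (hd.query x y hxy)
  · intro x c' hx
    by_cases h : x = m
    · subst h
      obtain rfl : c = c' := by simpa [hcc] using hx
      exact hspr
    · exact hd.spreading x c' (hcan x h ▸ hx)
  · intro x c' hx
    by_cases h : x = m
    · subst h
      obtain rfl : c = c' := by simpa [hcc] using hx
      exact hhom
    · exact hd.homogeneous x c' (hcan x h ▸ hx)
  · intro x c' hx
    rw [hE]
    by_cases h : x = m
    · subst h
      obtain rfl : c = c' := by simpa [hcc] using hx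
      exact .inr hlink
    · refine (hd.linked x c' (hcan x h ▸ hx)).imp_right fun h => ⟨?_, ?_⟩
      · intro n₁ n₂ c₁ c₂ h₁ h₂
        exact (h.app n₁ n₂ c₁ c₂ h₁ h₂).imp (hsub _) (hsub _)
      · intro n' c'' h₁ h₂
        exact hsub _ (h.abs n' c'' h₁ h₂)
  · intro x c' hx
    rw [hbu]
    by_cases h : x = m
    · subst h
      obtain rfl : c = c' := by simpa [hcc] using hx
      simp [hbc]
    · exact hd.building_ne x c' (hcan x h ▸ hx)
  · intro c' hb'
    exact hext.canonic _ _ (hd.canonic_self c' (hbu ▸ hb'))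
  · intro c' hb'
    exact hd.owner c' (hbu ▸ hb')
  · intro x c' hx
    by_cases h : c' = c
    · subst h
      rw [hqc, List.mem_append, List.mem_singleton] at hx
      rcases hx with hx | rfl
      · exact hext.canonic _ _ (hd.canonic_of_queue x c' hx)
      · exact hcc
    · exact hext.canonic _ _ (hd.canonic_of_queue x c' (hq c' h ▸ hx))
  · intro x c' hx
    rw [hbu]
    by_cases h : c' = c
    · subst h; exact hbc
    · exact hd.building_of_queue x c' (hq c' h ▸ hx)
  · intro x c' hx
    by_cases h : x = m
    · subst h
      obtain rfl : c = c' := by simpa [hcc] using hx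
      simp [hqc]
    · rcases hd.progress x c' (hcan x h ▸ hx) with h₁ | h₁ | h₁
      · exact .inl (hqueue x c' h₁)
      · exact .inr (.inl h₁)
      · exact .inr (.inr (hext.done h₁ fun y hs hy => hold x y hs (hE ▸ hy)))
  · rwa [hbu]
  · exact hs.active.2.1
  · exact hext.waiting hs.active.2.2 (fun x hx => .inl hx) fun c' _ hb' => by rwa [hbu]
  · exact hext.canonic _ _ hs.canonic
  · exact hext.settled hs.settled
  -- The visited node `n` is settled, so it receives no new edges and the snapshot of its edges
  -- taken at loop entry remains exhaustive.
  · intro x hx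
    rcases hs.treated x (hold n x hs.settled (hE ▸ hx)) with h | h | h
    · exact .inl h
    · exact .inr (.inl (hext.canonic _ _ h))
    · obtain rfl : m = x := by simpa using h
      exact .inr (.inl hcc)
  · exact hs.mem_of_rest
  · intro e he
    rw [hE]
    exact hsub _ (hs.edge_of_rest e he)

lemma Good.pop {c n : V} {q : List V} {σ : List (Frame V)}
    (h : G.Good Q S (.whileLoop c :: σ)) (hn : S.queueOf c = n :: q) :
    G.Good Q (S.setQueue c q) (.parentLoop c n {m | G.IsParent m n} :: σ) := by
  classical
  obtain ⟨hd, hb, hO, hw⟩ := h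
  have hq : ∀ c', c' ≠ c → (S.setQueue c q).queueOf c' = S.queueOf c' := fun c' h => by
    simp [State.setQueue, State.queueOf, h]
  have hqc : (S.setQueue c q).queueOf c = q := by simp [State.setQueue, State.queueOf]
  have hsub : ∀ x c', x ∈ (S.setQueue c q).queueOf c' → x ∈ S.queueOf c' := by
    intro x c' hx
    by_cases h : c' = c
    · subst h; rw [hqc] at hx; simp [hn, hx]
    · rwa [← hq c' h]
  have hext : Extends S (S.setQueue c q) := ⟨fun _ _ h => h, fun _ h => h⟩
  refine ⟨⟨hd.sound, hd.query, hd.spreading, hd.homogeneous, hd.linked, hd.building_ne,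
    hd.canonic_self, fun c' hc' => by simpa [Frame.owner] using hd.owner c' hc',
    fun x c' hx => hd.canonic_of_queue x c' (hsub x c' hx),
    fun x c' hx => hd.building_of_queue x c' (hsub x c' hx), fun x c' hx => ?_⟩,
    hd.canonic_of_queue n c (by simp [hn]), fun m hm => .inl hm, hb, hO,
    hext.waiting hw (fun x hx => .inl hx) fun _ _ h => h⟩
  rcases hd.progress x c' hx with h₁ | h₁ | h₁
  · by_cases h : c' = c
    · subst h
      rw [hn, List.mem_cons] at h₁
      rcases h₁ with rfl | h₁
      · simp [Frame.visited]
      · rw [hqc]; exact .inl h₁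
    · rw [hq c' h]; exact .inl h₁
  · simp only [mem_visiteds_cons, Frame.visited, reduceCtorEq, false_or] at h₁
    simp [h₁]
  · exact .inr (.inr (hext.done h₁ fun _ _ h => h))

lemma Good.complete {c : V} {σ : List (Frame V)} (h : G.Good Q S (.buildEnd c :: σ)) :
    G.Good Q (S.setBuilding c false) σ := by
  classical
  obtain ⟨hd, ⟨hb, hO, hw⟩, hqe⟩ := h
  have hbu : ∀ c', c' ≠ c → (S.setBuilding c false).building c' = S.building c' :=
    fun c' h => by simp [State.setBuilding, h]
  have hbc : (S.setBuilding c false).building c = some false := by simp [State.setBuilding]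
  have hq : (S.setBuilding c false).queueOf = S.queueOf := rfl
  have hcan : (S.setBuilding c false).canonic = S.canonic := rfl
  have hE : (S.setBuilding c false).edges = S.edges := rfl
  generalize S.setBuilding c false = S' at *
  have hcc := hd.canonic_self c (by simp [hb])
  have hext : Extends S S' := by
    refine ⟨fun n c' hn => by rwa [hcan], fun c' hc' => ?_⟩
    by_cases h : c' = c
    · subst h; exact hbc
    · rwa [hbu c' h]
  refine ⟨⟨by rw [hE]; exact hd.sound, by rw [hE]; exact hd.query,
    by rw [hcan]; exact hd.spreading, by rw [hcan]; exact hd.homogeneous,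
    by rw [hcan, hE]; exact hd.linked, ?_, ?_, ?_, by rw [hcan, hq]; exact hd.canonic_of_queue,
    ?_, ?_⟩, Waiting.control ?_⟩
  · intro n c' hn
    by_cases h : c' = c
    · subst h; simp [hbc]
    · rw [hbu c' h]; exact hd.building_ne n c' (hcan ▸ hn)
  · intro c' hb'
    rw [hcan]
    by_cases h : c' = c
    · subst h; exact hcc
    · exact hd.canonic_self c' (hbu c' h ▸ hb')
  · intro c' hb'
    by_cases h : c' = c
    · subst h; simp [hbc] at hb'
    · have := hd.owner c' (hbu c' h ▸ hb')
      simpa [Frame.owner, Ne.symm h] using this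
  · intro n c' hn
    rw [hq] at hn
    -- Clearing the flag is compatible with `building_of_queue` because the queue of `c` is empty.
    have h : c' ≠ c := by rintro rfl; simp [hqe] at hn
    rw [hbu c' h]
    exact hd.building_of_queue n c' hn
  · intro n c' hn
    rcases hd.progress n c' (hcan ▸ hn) with h₁ | h₁ | h₁
    · rw [hq]; exact .inl h₁
    · simp only [mem_visiteds_cons, Frame.visited, reduceCtorEq, false_or] at h₁
      exact .inr (.inl h₁)
    · exact .inr (.inr (hext.done h₁ fun m _ hm => hE ▸ hm))
  -- Completing the class of `c` settles `c` itself, which fills the hole of the loop below. The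
  -- other flags on the stack survive because `c` owns no frame there.
  · refine hext.waiting hw (fun x hx => .inr ?_) fun c' hc' hb' => ?_
    · obtain rfl : c = x := by simpa using hx
      exact ⟨c, by rwa [hcan], hbc⟩
    · rwa [hbu c' (by rintro rfl; exact hO hc')]

/-- The invariant of program runs. -/
def RunInv (G : PreLambdaGraph V A) (Q : V → V → Prop) : Config V → Prop
  | .fail => True
  | .run S => G.Good Q (S.flush.goto []) S.flush.stack

/-! ### Invariance along program runs -/

lemma RunInv.good {σ : List (Frame V)} (h : RunInv G Q (.run S)) (hσ : S.stack = σ)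
    (hf : S.flush = S) : G.Good Q (S.goto []) σ := by
  simpa only [RunInv, hf, hσ] using h

lemma Good.runInv {σ : List (Frame V)} (h : G.Good Q (S.goto []) σ) :
    RunInv G Q (.run (S.goto σ)) := by
  simp only [RunInv, h.control.flush]
  exact h

lemma Good.goto {σ σ' : List (Frame V)} (h : G.Good Q (S.goto []) σ)
    (hO : ∀ c ∈ owners σ, c ∈ owners σ')
    (hT : ∀ n ∈ visiteds σ, n ∈ visiteds σ' ∨
      ∃ c, S.canonic n = some c ∧ G.Done (S.goto []) c n)
    (hC : G.Control (S.goto []) σ') : RunInv G Q (.run (S.goto σ')) :=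
  Good.runInv ⟨h.data.mono hO hT, hC⟩

lemma RunInv.of_initial (hS : S.IsInitial Q) : RunInv G Q (.run S) := by
  have hf : S.flush = S := by simp [State.flush, hS.stack]
  simp only [RunInv, hf, hS.stack]
  refine ⟨⟨fun n m h => ?_, fun n m h => (hS.edges n m).2 (.inl h), ?_, ?_, ?_, ?_, ?_, ?_, ?_, ?_,
    ?_⟩, rfl⟩
  · rcases (hS.edges n m).1 h with h | h
    · exact .base h
    · exact .symm (.base h)
  all_goals simp [State.goto, State.queueOf, hS.canonic, hS.building, hS.queue]

lemma RunInv.step {C C' : Config V} (hC : RunInv G Q C) (hstep : G.Step C C') :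
    RunInv G Q C' := by
  classical
  cases hstep with
  | parentFail => trivial
  | siblingFail => trivial
  | enqueueFail => trivial
  | @callBlindCheck S σ hσ =>
    have h := hC.good hσ (by simp [State.flush, hσ])
    obtain rfl : σ = [] := h.control
    exact h.goto (by simp [Frame.owner]) (by simp +contextual [Frame.visited])
      (fun n => .inl (Set.mem_univ n))
  | @nodeNext S σ rest n hσ hn =>
    have h := hC.good hσ (by simp [State.flush, hσ])
    have hw : G.Waiting _ none _ := h.control
    cases σ with
    | cons _ _ => simp [Waiting] at hw
    | nil =>
      refine h.goto (by simp [Frame.owner]) (by simp +contextual [Frame.visited])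
        ⟨rfl, fun m => ?_⟩
      by_cases hm : m = n
      · exact .inr (.inr (by rw [hm]))
      · rcases hw m with h₁ | h₁ | h₁
        · exact .inl ⟨h₁, hm⟩
        · exact .inr (.inl h₁)
        · simp at h₁
  | @nodeExit S σ rest hσ hr =>
    subst hr
    have h := hC.good hσ (by simp [State.flush, hσ])
    have hw : G.Waiting _ none _ := h.control
    cases σ with
    | cons _ _ => simp [Waiting] at hw
    | nil =>
      refine h.goto (by simp [Frame.owner]) (by simp +contextual [Frame.visited]) fun m => ?_
      simpa using hw m
  | @nodeBuild S σ rest n hσ hn =>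
    have h := hC.good hσ (by simp [State.flush, hσ])
    obtain ⟨rfl, hw⟩ := h.control
    exact Good.build (h.data.mono (by simp [Frame.owner]) fun _ h => .inl h)
      (by simp [Frame.visited]) hn hw
  | @nodeSkip S σ rest n c' hσ hn =>
    have h := hC.good hσ (by simp [State.flush, hσ])
    obtain ⟨rfl, hw⟩ := h.control
    refine h.goto (by simp [Frame.owner]) (by simp +contextual [Frame.visited]) fun m => ?_
    rcases hw m with h₁ | h₁ | h₁
    · exact .inl h₁
    · exact .inr (.inl h₁)
    · obtain rfl : n = m := by simpa using h₁
      exact .inr (.inl ⟨c', hn⟩)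
  | @buildCanonic S σ c hσ =>
    -- The states before and after this assignment have the same flush.
    simp only [RunInv, State.flush, hσ] at hC
    exact hC
  | @buildFlag S σ c hσ =>
    simp only [RunInv, State.flush, hσ] at hC
    exact hC
  | @buildQueue S σ c hσ =>
    simp only [RunInv, State.flush, hσ] at hC
    exact hC
  | @whilePop S σ c n l hσ hq =>
    exact Good.pop (hC.good hσ (by simp [State.flush, hσ])) hq
  | @whileExit S σ c hσ hq =>
    have h := hC.good hσ (by simp [State.flush, hσ])
    exact h.goto (by simp [Frame.owner]) (by simp +contextual [Frame.visited]) ⟨h.control, hq⟩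
  | @parentNext S σ c n m rest hσ hm =>
    have h := hC.good hσ (by simp [State.flush, hσ])
    obtain ⟨h₁, h₂, h₃⟩ := h.control
    refine h.goto (by simp [Frame.owner]) (by simp +contextual [Frame.visited])
      ⟨h₁, fun x hx => ?_, h₃⟩
    by_cases hxm : x = m
    · exact .inr (.inr (by rw [hxm]))
    · rcases h₂ x hx with h₄ | h₄ | h₄
      · exact .inl ⟨h₄, hxm⟩
      · exact .inr (.inl h₄)
      · simp at h₄
  | @parentExit S σ c n rest hσ hr =>
    subst hr
    have h := hC.good hσ (by simp [State.flush, hσ])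
    obtain ⟨h₁, h₂, h₃⟩ := h.control
    refine h.goto (by simp [Frame.owner]) (by simp +contextual [Frame.visited])
      ⟨h₃, h₁, fun x hx => ?_, fun x hx => .inl ?_, fun e he => ?_, fun e he => ?_⟩
    · simpa using h₂ x hx
    · exact Multiset.mem_filter.2 ⟨hx, Sym2.mem_mk_left n x⟩
    · exact (Multiset.mem_filter.1 he).2
    · exact (Multiset.mem_filter.1 he).1
  | @parentBuild S σ c n m rest hσ hm =>
    have h := hC.good hσ (by simp [State.flush, hσ])
    exact Good.build (h.data.mono (by simp [Frame.owner]) fun _ h => .inl h)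
      (by simp [Frame.visited]) hm h.control
  | @parentSkip S σ c n m c' rest hσ hm hb =>
    have h := hC.good hσ (by simp [State.flush, hσ])
    refine h.goto (by simp [Frame.owner]) (by simp +contextual [Frame.visited])
      (Extends.waiting ⟨fun _ _ h => h, fun _ h => h⟩ h.control (fun x hx => .inr ?_)
        fun _ _ h => h)
    obtain rfl : m = x := by simpa using hx
    refine ⟨c', hm, ?_⟩
    -- The flag of a representative is defined, so if it is not `true` it is `false` and the class
    -- is complete.
    have := h.data.building_ne m c' hm
    cases hc : S.building c' with
    | none => exact absurd hc this
    | some b => cases b with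
      | false => exact hc
      | true => exact absurd hc hb
  | @siblingNext S σ c n m rest hσ =>
    have h := hC.good hσ (by simp [State.flush, hσ])
    obtain ⟨h₁, h₂, h₃, h₄, h₅, h₆⟩ := h.control
    refine h.goto (by simp [Frame.owner]) (by simp +contextual [Frame.visited])
      ⟨⟨h₁, h₂, h₃, fun x hx => ?_, fun e he => h₅ e (Multiset.mem_cons_of_mem he),
        fun e he => h₆ e (Multiset.mem_cons_of_mem he)⟩, h₆ _ (Multiset.mem_cons_self _ _)⟩
    rcases h₄ x hx with h₇ | h₇ | h₇
    · rcases Multiset.mem_cons.1 h₇ with h₈ | h₈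
      · exact .inr (.inr (by rw [Sym2.congr_right.1 h₈]))
      · exact .inl h₈
    · exact .inr (.inl h₇)
    · simp at h₇
  | @siblingExit S σ c n hσ =>
    have h := hC.good hσ (by simp [State.flush, hσ])
    obtain ⟨h₁, h₂, h₃, h₄, -, -⟩ := h.control
    refine h.goto (by simp [Frame.owner]) (fun x hx => ?_) h₁
    simp only [mem_visiteds_cons, Frame.visited, Option.some.injEq] at hx
    rcases hx with rfl | hx
    -- With no edges left to treat, `n` is `Done` and may cease to be visited.
    · exact .inr ⟨c, h₂, h₃, fun m hm => by simpa using h₄ m hm⟩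
    · simp [hx]
  | @siblingEnqueue S σ c n m rest hσ hm =>
    have h := hC.good hσ (by simp [State.flush, hσ])
    exact h.goto (by simp [Frame.owner]) (by simp +contextual [Frame.visited])
      ⟨hm, n, rest, σ, rfl, h.control⟩
  | @siblingSkip S σ c n m c' rest hσ hm hc =>
    subst hc
    have h := hC.good hσ (by simp [State.flush, hσ])
    obtain ⟨⟨h₁, h₂, h₃, h₄, h₅, h₆⟩, -⟩ := h.control
    refine h.goto (by simp [Frame.owner]) (by simp +contextual [Frame.visited])
      ⟨h₁, h₂, h₃, fun x hx => ?_, h₅, h₆⟩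
    rcases h₄ x hx with h₇ | h₇ | h₇
    · exact .inl h₇
    · exact .inr (.inl h₇)
    · obtain rfl : m = x := by simpa using h₇
      exact .inr (.inl hm)
  | @buildEnd S σ c hσ =>
    have h := hC.good hσ (by simp [State.flush, hσ])
    exact h.complete.runInv
  | @enqueueAbs S σ m c m' c' hσ hlm hlc =>
    have h := hC.good hσ (by simp [State.flush, hσ])
    obtain ⟨hm, n, rest, σ, rfl, hs, hnm⟩ := h.control
    refine Good.enqueue (E := s(m', c') ::ₘ S.edges)
      (h.data.mono (by simp [Frame.owner]) (by simp +contextual [Frame.visited])) hs hm hnm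
      (fun e he => Multiset.mem_cons_of_mem he) (fun x y hxy => ?_) (by simp [hlm, hlc]; trivial)
      ⟨by simp [hlm], fun a b h₁ h₂ => ?_⟩
    · rcases Multiset.mem_cons.1 hxy with h₁ | h₁
      · rcases Sym2.eq_iff.1 h₁ with ⟨rfl, rfl⟩ | ⟨rfl, rfl⟩
        · exact .inr ⟨fun h => .down hlm hlc h, .inl (G.isParent_abs hlm)⟩
        · exact .inr ⟨fun h => .symm (.down hlm hlc h), .inr (G.isParent_abs hlc)⟩
      · exact .inl h₁
    · simp only [hlm, hlc, Label.abs.injEq] at h₁ h₂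
      simp [h₁, h₂]
  | @enqueueApp S σ m c m₁ m₂ c₁ c₂ hσ hlm hlc =>
    have h := hC.good hσ (by simp [State.flush, hσ])
    obtain ⟨hm, n, rest, σ, rfl, hs, hnm⟩ := h.control
    refine Good.enqueue (E := s(m₂, c₂) ::ₘ s(m₁, c₁) ::ₘ S.edges)
      (h.data.mono (by simp [Frame.owner]) (by simp +contextual [Frame.visited])) hs hm hnm
      (fun e he => Multiset.mem_cons_of_mem (Multiset.mem_cons_of_mem he)) (fun x y hxy => ?_)
      (by simp [hlm, hlc]; trivial)
      ⟨fun a b d e h₁ h₂ => ?_, by simp [hlm]⟩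
    · rcases Multiset.mem_cons.1 hxy with h₁ | h₁
      · rcases Sym2.eq_iff.1 h₁ with ⟨rfl, rfl⟩ | ⟨rfl, rfl⟩
        · exact .inr ⟨fun h => .right hlm hlc h, .inl (G.isParent_right hlm)⟩
        · exact .inr ⟨fun h => .symm (.right hlm hlc h), .inr (G.isParent_right hlc)⟩
      · rcases Multiset.mem_cons.1 h₁ with h₁ | h₁
        · rcases Sym2.eq_iff.1 h₁ with ⟨rfl, rfl⟩ | ⟨rfl, rfl⟩
          · exact .inr ⟨fun h => .left hlm hlc h, .inl (G.isParent_left hlm)⟩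
          · exact .inr ⟨fun h => .symm (.left hlm hlc h), .inr (G.isParent_left hlc)⟩
        · exact .inl h₁
    · simp only [hlm, hlc, Label.app.injEq] at h₁ h₂
      simp [h₁, h₂]
  | @enqueueBVar S σ m c l l' hσ hlm hlc =>
    have h := hC.good hσ (by simp [State.flush, hσ])
    obtain ⟨hm, n, rest, σ, rfl, hs, hnm⟩ := h.control
    exact Good.enqueue (E := S.edges)
      (h.data.mono (by simp [Frame.owner]) (by simp +contextual [Frame.visited])) hs hm hnm
      (fun e he => he) (fun x y hxy => .inl hxy) (by simp [hlm, hlc]; trivial)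
      ⟨by simp [hlm], by simp [hlm]⟩
  | @enqueueFVar S σ m c a a' hσ hlm hlc =>
    have h := hC.good hσ (by simp [State.flush, hσ])
    obtain ⟨hm, n, rest, σ, rfl, hs, hnm⟩ := h.control
    exact Good.enqueue (E := S.edges)
      (h.data.mono (by simp [Frame.owner]) (by simp +contextual [Frame.visited])) hs hm hnm
      (fun e he => he) (fun x y hxy => .inl hxy) (by simp [hlm, hlc]; trivial)
      ⟨by simp [hlm], by simp [hlm]⟩
  | @enqueueCanonic S σ m c hσ =>
    simp only [RunInv, State.flush, hσ] at hC
    exact hC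
  | @enqueuePush S σ m c hσ =>
    simp only [RunInv, State.flush, hσ] at hC
    exact Good.runInv hC

lemma RunInv.of_reachable {C : Config V} (hS : S.IsInitial Q)
    (hC : Relation.ReflTransGen G.Step (.run S) C) : RunInv G Q C := by
  induction hC with
  | refl => exact .of_initial hS
  | tail _ hstep ih => exact ih.step hstep

/-! ### Final states -/

lemma stack_eq_nil_of_final (hS : RunInv G Q (.run S)) (hfin : ∀ C, ¬ G.Step (.run S) C) :
    S.stack = [] := by
  obtain ⟨E, κ, β, q, st⟩ := S
  cases st with
  | nil => rfl
  | cons f σ =>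
    exfalso
    cases f with
    | blindCheck => exact hfin _ (.callBlindCheck rfl)
    | nodeLoop rest =>
      rcases rest.eq_empty_or_nonempty with h | ⟨n, h⟩
      · exact hfin _ (.nodeExit rfl h)
      · exact hfin _ (.nodeNext rfl h)
    | nodeBody rest n =>
      cases h : κ n with
      | none => exact hfin _ (.nodeBuild rfl h)
      | some c => exact hfin _ (.nodeSkip rfl h)
    | buildCanonic c => exact hfin _ (.buildCanonic rfl)
    | buildFlag c => exact hfin _ (.buildFlag rfl)
    | buildQueue c => exact hfin _ (.buildQueue rfl)
    | whileLoop c =>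
      cases h : State.queueOf ⟨E, κ, β, q, .whileLoop c :: σ⟩ c with
      | nil => exact hfin _ (.whileExit rfl h)
      | cons n l => exact hfin _ (.whilePop rfl h)
    | parentLoop c n rest =>
      rcases rest.eq_empty_or_nonempty with h | ⟨m, h⟩
      · exact hfin _ (.parentExit rfl h)
      · exact hfin _ (.parentNext rfl h)
    | parentBody c n rest m =>
      cases h : κ m with
      | none => exact hfin _ (.parentBuild rfl h)
      | some c' =>
        by_cases hb : β c' = some true
        · exact hfin _ (.parentFail rfl h hb)
        · exact hfin _ (.parentSkip rfl h hb)
    | siblingLoop c n rest =>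
      -- Only here does progress depend on the invariant: a remaining edge can be followed because
      -- `n` is one of its endpoints.
      have hs : G.SiblingInv _ none c n rest σ := (hS.good rfl rfl).control
      induction rest using Multiset.induction_on with
      | empty => exact hfin _ (.siblingExit rfl)
      | cons e rest _ =>
        obtain ⟨m, rfl⟩ := hs.mem_of_rest e (Multiset.mem_cons_self _ _)
        exact hfin _ (.siblingNext rfl)
    | siblingBody c n rest m =>
      cases h : κ m with
      | none => exact hfin _ (.siblingEnqueue rfl h)
      | some c' =>
        by_cases hc : c' = c
        · exact hfin _ (.siblingSkip rfl h hc)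
        · exact hfin _ (.siblingFail rfl h hc)
    | buildEnd c => exact hfin _ (.buildEnd rfl)
    | enqueueCase m c =>
      by_cases hh : (G.label m).Homogeneous (G.label c)
      · cases hm : G.label m <;> cases hc : G.label c <;>
          simp only [hm, hc, Label.Homogeneous] at hh
        · exact hfin _ (.enqueueApp rfl hm hc)
        · exact hfin _ (.enqueueAbs rfl hm hc)
        · exact hfin _ (.enqueueFVar rfl hm hc)
        · exact hfin _ (.enqueueBVar rfl hm hc)
      · exact hfin _ (.enqueueFail rfl hh)
    | enqueueCanonic m c => exact hfin _ (.enqueueCanonic rfl)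
    | enqueuePush m c => exact hfin _ (.enqueuePush rfl)

/-! ### Equality of representatives at the end of a run -/

lemma Good.done_of_nil (h : G.Good Q S []) {n c : V} (hn : S.canonic n = some c) :
    G.Done S c n := by
  rcases h.data.progress n c hn with h₁ | h₁ | h₁
  · simpa using h.data.owner c (h.data.building_of_queue n c h₁)
  · simp at h₁
  · exact h₁

lemma Good.sameCanonic_of_edge (h : G.Good Q S []) {n m : V} (hnm : s(n, m) ∈ S.edges) :
    S.SameCanonic n m := by
  obtain ⟨c, hc⟩ := h.control n
  exact ⟨c, hc, (h.done_of_nil hc).2 m hnm⟩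

lemma _root_.LambdaSharing.State.SameCanonic.symm {n m : V} (h : S.SameCanonic n m) :
    S.SameCanonic m n :=
  let ⟨c, h₁, h₂⟩ := h
  ⟨c, h₂, h₁⟩

lemma _root_.LambdaSharing.State.SameCanonic.trans {n m p : V} (h : S.SameCanonic n m)
    (h' : S.SameCanonic m p) : S.SameCanonic n p := by
  obtain ⟨c, h₁, h₂⟩ := h
  obtain ⟨d, h₃, h₄⟩ := h'
  obtain rfl : c = d := by simpa [h₂] using h₃
  exact ⟨c, h₁, h₄⟩

lemma Good.sameCanonic_refl (h : G.Good Q S []) (n : V) : S.SameCanonic n n := by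
  obtain ⟨c, hc⟩ := h.control n
  exact ⟨c, hc, hc⟩

/-- Homogeneity forces the representative to be an application; the query edges given by `linked`
then identify the classes of the children. -/
lemma Good.label_of_canonic_app (h : G.Good Q S []) {n c n₁ n₂ : V}
    (hn : S.canonic n = some c) (hl : G.label n = .app n₁ n₂) :
    ∃ c₁ c₂, G.label c = .app c₁ c₂ ∧ S.SameCanonic n₁ c₁ ∧ S.SameCanonic n₂ c₂ := by
  rcases h.data.linked n c hn with rfl | hk
  · exact ⟨n₁, n₂, hl, h.sameCanonic_refl _, h.sameCanonic_refl _⟩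
  · have hh := h.data.homogeneous n c hn
    cases hc : G.label c <;> simp only [hl, hc, Label.Homogeneous] at hh
    rename_i c₁ c₂
    exact ⟨c₁, c₂, rfl, (hk.app _ _ _ _ hl hc).imp h.sameCanonic_of_edge h.sameCanonic_of_edge⟩

lemma Good.label_of_canonic_abs (h : G.Good Q S []) {n c n' : V}
    (hn : S.canonic n = some c) (hl : G.label n = .abs n') :
    ∃ c', G.label c = .abs c' ∧ S.SameCanonic n' c' := by
  rcases h.data.linked n c hn with rfl | hk
  · exact ⟨n', hl, h.sameCanonic_refl _⟩
  · have hh := h.data.homogeneous n c hn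
    cases hc : G.label c <;> simp only [hl, hc, Label.Homogeneous] at hh
    rename_i c'
    exact ⟨c', rfl, h.sameCanonic_of_edge (hk.abs _ _ hl hc)⟩

/-- Both nodes are compared with their common representative, whose children mediate between theirs.
-/
lemma Good.propagated_sameCanonic (h : G.Good Q S []) : G.Propagated S.SameCanonic where
  left := by
    rintro n m n₁ n₂ m₁ m₂ hn hm ⟨c, hc, hc'⟩
    obtain ⟨c₁, c₂, h₁, h₂, -⟩ := h.label_of_canonic_app hc hn
    obtain ⟨d₁, d₂, h₃, h₄, -⟩ := h.label_of_canonic_app hc' hm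
    obtain ⟨rfl, rfl⟩ : c₁ = d₁ ∧ c₂ = d₂ := by simpa [h₁] using h₃
    exact h₂.trans h₄.symm
  right := by
    rintro n m n₁ n₂ m₁ m₂ hn hm ⟨c, hc, hc'⟩
    obtain ⟨c₁, c₂, h₁, -, h₂⟩ := h.label_of_canonic_app hc hn
    obtain ⟨d₁, d₂, h₃, -, h₄⟩ := h.label_of_canonic_app hc' hm
    obtain ⟨rfl, rfl⟩ : c₁ = d₁ ∧ c₂ = d₂ := by simpa [h₁] using h₃
    exact h₂.trans h₄.symm
  down := by
    rintro n m n' m' hn hm ⟨c, hc, hc'⟩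
    obtain ⟨c₁, h₁, h₂⟩ := h.label_of_canonic_abs hc hn
    obtain ⟨d₁, h₃, h₄⟩ := h.label_of_canonic_abs hc' hm
    obtain rfl : c₁ = d₁ := by simpa [h₁] using h₃
    exact h₂.trans h₄.symm

lemma Good.sameCanonic_iff (h : G.Good Q S []) (n m : V) :
    S.SameCanonic n m ↔ G.Spreading Q n m := by
  constructor
  · rintro ⟨c, hn, hm⟩
    exact .trans (h.data.spreading n c hn) (.symm (h.data.spreading m c hm))
  · intro hnm
    induction hnm with
    | base hq => exact h.sameCanonic_of_edge (h.data.query _ _ hq)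
    | refl n => exact h.sameCanonic_refl n
    | symm _ ih => exact ih.symm
    | trans _ _ ih ih' => exact ih.trans ih'
    | left hn hm _ ih => exact h.propagated_sameCanonic.left _ _ _ _ _ _ hn hm ih
    | right hn hm _ ih => exact h.propagated_sameCanonic.right _ _ _ _ _ _ hn hm ih
    | down hn hm _ ih => exact h.propagated_sameCanonic.down _ _ _ _ hn hm ih

lemma Good.homogeneousRel_spreading (h : G.Good Q S []) :
    G.HomogeneousRel (G.Spreading Q) := by
  intro n m hnm
  obtain ⟨c, hn, hm⟩ := (h.sameCanonic_iff n m).2 hnm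
  exact (h.data.homogeneous n c hn).trans (h.data.homogeneous m c hm).symm

variable (G Q) in
lemma equivalence_spreading : Equivalence (G.Spreading Q) :=
  ⟨.refl, .symm, .trans⟩

variable (G Q) in
lemma propagated_spreading : G.Propagated (G.Spreading Q) where
  left _ _ _ _ _ _ hn hm h := .left hn hm h
  right _ _ _ _ _ _ hn hm h := .right hn hm h
  down _ _ _ _ hn hm h := .down hn hm h

end PreLambdaGraph

end LambdaSharing

theorem mainTheorem4 {V A : Type*} (G : LambdaSharing.LambdaGraph V A)
    (Q : V → V → Prop) (hQ : G.IsQuery Q)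
    (S : LambdaSharing.State V) (hS : G.IsFinal Q S) :
    (∀ n m, S.SameCanonic n m ↔ G.Spreading Q n m) ∧
      G.HomogeneousRel (G.Spreading Q) ∧
      G.BlindSharingEquivalence (G.Spreading Q) := by
  obtain ⟨⟨S₀, hS₀, hrun⟩, hfin⟩ := hS
  have hinv := LambdaSharing.PreLambdaGraph.RunInv.of_reachable hS₀ hrun
  have hnil := LambdaSharing.PreLambdaGraph.stack_eq_nil_of_final hinv hfin
  have hgood := hinv.good hnil (by simp [LambdaSharing.State.flush, hnil])
  have hhom := hgood.homogeneousRel_spreading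
  exact ⟨hgood.sameCanonic_iff, hhom, G.equivalence_spreading Q, hhom, G.propagated_spreading Q⟩
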